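/- Let $X$ be a closed hyperbolic surface, that is, a compact connected oriented surface without boundary with a hyperbolic (constant curvature $-1$) metric. For $q\in X$ let $\operatorname{inj}_X(q)$ denote the injectivity radius of $X$ at $q$, i.e. half of the length of a shortest nontrivial geodesic loop based at $q$ (the loop need not be smooth at $q$). Let $p\in X$ satisfy $\operatorname{inj}_X(p)>\operatorname{arcsinh}(1)$, and let $\sigma:[0,2\operatorname{inj}_X(p)]\to X$ be a shortest nontrivial geodesic loop based at $p$, parametrized by arc length. Then the minimum of $\operatorname{inj}_X$ along $\sigma$ exists and $$\min_{s\in[0,2\operatorname{inj}_X(p)]}\operatorname{inj}_X(\sigma(s))\ \ge\ \ln\left(e^{-\sqrt2}+\sqrt{e^{-2\sqrt2}+1}\right),$$ where the constant on the right lies strictly between $0.2407$ and $0.2408$. -/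

import Mathlib

open Set Topology

namespace HyperbolicSurface

/-- A hyperbolic structure on an oriented surface: an atlas of charts into the hyperbolic plane
(Mathlib's upper half-plane `UpperHalfPlane` with its hyperbolic metric) all of whose coordinate
changes are, near each point, restrictions of orientation-preserving isometries of the hyperbolic
plane, i.e. of Möbius transformations `z ↦ (a z + b) / (c z + d)` with real coefficients and
`a d - b c = 1`. -/
class IsHyperbolicSurface (X : Type*) [TopologicalSpace X] [ChartedSpace UpperHalfPlane X] :
    Prop where
  locally_moebius : ∀ e ∈ atlas UpperHalfPlane X, ∀ e' ∈ atlas UpperHalfPlane X,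
    ∀ z ∈ (e.symm.trans e').source,
      ∃ A : Matrix.SpecialLinearGroup (Fin 2) ℝ, ∀ᶠ w in 𝓝 z, (e.symm.trans e') w = A • w

variable {X : Type*} [TopologicalSpace X] [ChartedSpace UpperHalfPlane X]

/-- `σ` restricted to `[0, L]` is a geodesic of `X` parametrized by arc length: it is continuous
and, near each parameter `s`, its expression in a chart around `σ s` is a distance-preserving map
into the hyperbolic plane (a unit-speed geodesic arc). -/
def IsGeodesic (σ : ℝ → X) (L : ℝ) : Prop :=
  ContinuousOn σ (Icc 0 L) ∧
    ∀ s ∈ Icc 0 L, ∃ U ∈ 𝓝[Icc 0 L] s, ∀ t ∈ U, ∀ t' ∈ U,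
      dist (chartAt UpperHalfPlane (σ s) (σ t)) (chartAt UpperHalfPlane (σ s) (σ t')) = |t - t'|

/-- `σ : [0, L] → X` is a nontrivial (nonconstant) geodesic loop based at `p`, parametrized by arc
length, so of length `L`. It need not be smooth at the base point. -/
def IsGeodesicLoop (p : X) (σ : ℝ → X) (L : ℝ) : Prop :=
  0 < L ∧ σ 0 = p ∧ σ L = p ∧ IsGeodesic σ L

/-- `σ : [0, L] → X` is a shortest nontrivial geodesic loop based at `p`. -/
def IsShortestGeodesicLoop (p : X) (σ : ℝ → X) (L : ℝ) : Prop :=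
  IsGeodesicLoop p σ L ∧ ∀ (τ : ℝ → X) (L' : ℝ), IsGeodesicLoop p τ L' → L ≤ L'

/-- The injectivity radius of `X` at `p`: half of the (least) length of a nontrivial geodesic loop
based at `p`. -/
noncomputable def injRadius (p : X) : ℝ :=
  sInf {L : ℝ | ∃ σ : ℝ → X, IsGeodesicLoop p σ L} / 2

end HyperbolicSurface

/-! The surface is developed from the hyperbolic plane. Compactness yields a locally Möbius map `E`
from all of `ℍ` to `X` through `p` (`exists_locallyMoebius`). Geodesics lift through `E`, so
geodesic loops at `E w` come from deck transformations `g` without fixed points, with length `dist w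
(g • w)`.

The core is `sinh_half_dist_smul_le`. If `α`, `β` are the boundary fixed points of `g`, then `sinh
(dist z (g • z) / 2) ^ 2` is a constant times `|z - α|² / y` times `|z - β|² / y`. These are
exponentials of 1-Lipschitz Busemann functions, so the `sinh` grows by at most `exp (dist z w)`.
Taking the infimum over `g` gives the same bound for `sinh (injRadius (E z))`.

Every point of the loop is within `R = injRadius p` of an end along the loop, so its `sinh
injRadius` is at least `exp (-R) * sinh R = (1 - exp (-2R)) / 2`. For `R > arsinh 1` this exceeds
`√2 - 1`, which is at least `exp (-√2)`. -/

namespace HyperbolicSurface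

open UpperHalfPlane Matrix

/-! ### Möbius transformations and geodesic lines of the half-plane -/

/-- The vertical geodesic line `t ↦ i eᵗ`. -/
noncomputable def stdLine (t : ℝ) : ℍ := ⟨⟨0, Real.exp t⟩, Real.exp_pos t⟩

theorem isometry_stdLine : Isometry stdLine := isometry_vertical_line 0

@[simp] theorem stdLine_re (t : ℝ) : (stdLine t).re = 0 := rfl

@[simp] theorem stdLine_im (t : ℝ) : (stdLine t).im = Real.exp t := rfl

theorem cosh_dist_stdLine (z : ℍ) (t : ℝ) :
    2 * z.im * Real.exp t * Real.cosh (dist z (stdLine t)) =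
      z.re ^ 2 + z.im ^ 2 + Real.exp t ^ 2 := by
  have h1 := z.im_pos.ne'
  have h2 := (Real.exp_pos t).ne'
  rw [cosh_dist']
  simp only [stdLine_re, stdLine_im]
  field_simp
  ring

/-- A point of the hyperbolic plane is determined by its distances to two points of a geodesic
line, when these are compatible with a point of the line. -/
theorem eq_stdLine_of_dist {z : ℍ} {a b u : ℝ} (hab : a ≠ b)
    (ha : dist z (stdLine a) = |u - a|) (hb : dist z (stdLine b) = |u - b|) : z = stdLine u := by
  have h1 := cosh_dist_stdLine z a
  have h2 := cosh_dist_stdLine z b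
  rw [ha, Real.cosh_abs, Real.cosh_eq] at h1
  rw [hb, Real.cosh_abs, Real.cosh_eq] at h2
  have e1 : Real.exp a * Real.exp (u - a) = Real.exp u := by rw [← Real.exp_add]; ring_nf
  have e2 : Real.exp b * Real.exp (u - b) = Real.exp u := by rw [← Real.exp_add]; ring_nf
  have e3 : Real.exp u * Real.exp (-(u - a)) = Real.exp a := by rw [← Real.exp_add]; ring_nf
  have e4 : Real.exp u * Real.exp (-(u - b)) = Real.exp b := by rw [← Real.exp_add]; ring_nf
  have hu := Real.exp_pos u
  have hne : Real.exp a ^ 2 - Real.exp b ^ 2 ≠ 0 := by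
    rw [sub_ne_zero]
    intro h
    exact hab (Real.exp_injective
      ((pow_left_inj₀ (Real.exp_pos a).le (Real.exp_pos b).le two_ne_zero).1 h))
  have k1 : Real.exp u * (z.re ^ 2 + z.im ^ 2 + Real.exp a ^ 2) =
      z.im * (Real.exp u ^ 2 + Real.exp a ^ 2) := by
    linear_combination (-Real.exp u) * h1 + z.im * Real.exp u * e1 + z.im * Real.exp a * e3
  have k2 : Real.exp u * (z.re ^ 2 + z.im ^ 2 + Real.exp b ^ 2) =
      z.im * (Real.exp u ^ 2 + Real.exp b ^ 2) := by
    linear_combination (-Real.exp u) * h2 + z.im * Real.exp u * e2 + z.im * Real.exp b * e4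
  -- Subtracting the two equations eliminates `z.re ^ 2 + z.im ^ 2`.
  have him : z.im = Real.exp u := by
    have : (Real.exp u - z.im) * (Real.exp a ^ 2 - Real.exp b ^ 2) = 0 := by
      linear_combination k1 - k2
    rcases mul_eq_zero.1 this with h | h
    · linarith
    · exact absurd h hne
  have hre : z.re = 0 := by
    rw [him] at k1
    have : Real.exp u * z.re ^ 2 = 0 := by linear_combination k1
    rcases mul_eq_zero.1 this with h | h
    · exact absurd h hu.ne'
    · exact pow_eq_zero_iff two_ne_zero |>.1 h
  exact UpperHalfPlane.ext_re_im hre him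

theorem re_smul_SL (g : SpecialLinearGroup (Fin 2) ℝ) (z : ℍ) :
    (g • z).re = (g 0 0 * g 1 0 * (z.re ^ 2 + z.im ^ 2) + (g 0 0 * g 1 1 + g 0 1 * g 1 0) * z.re
      + g 0 1 * g 1 1) / ((g 1 0 * z.re + g 1 1) ^ 2 + (g 1 0 * z.im) ^ 2) := by
  rw [← UpperHalfPlane.coe_re, coe_specialLinearGroup_apply]
  simp [Complex.div_re, Complex.normSq_apply]
  rw [← add_div]
  congr 1 <;> ring

theorem im_smul_SL (g : SpecialLinearGroup (Fin 2) ℝ) (z : ℍ) :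
    (g • z).im = z.im / ((g 1 0 * z.re + g 1 1) ^ 2 + (g 1 0 * z.im) ^ 2) := by
  have hdet := g.det_coe
  rw [Matrix.det_fin_two] at hdet
  rw [← UpperHalfPlane.coe_im, coe_specialLinearGroup_apply]
  simp [Complex.div_im, Complex.normSq_apply]
  rw [← sub_div]
  congr 1
  · linear_combination z.im * hdet
  · ring

theorem stdLine_log_im_of_re_eq_zero {z : ℍ} (hz : z.re = 0) : stdLine (Real.log z.im) = z :=
  UpperHalfPlane.ext_re_im (by simp [hz]) (by simp [Real.exp_log z.im_pos])

/-- The Möbius transformation `z ↦ e^s z`. -/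
noncomputable def dilation (s : ℝ) : SpecialLinearGroup (Fin 2) ℝ :=
  ⟨!![Real.exp (s / 2), 0; 0, Real.exp (-(s / 2))], by
    rw [Matrix.det_fin_two_of, ← Real.exp_add]; simp⟩

theorem dilation_smul_stdLine (s t : ℝ) : dilation s • stdLine t = stdLine (t + s) := by
  apply UpperHalfPlane.ext_re_im
  · rw [re_smul_SL]; simp [dilation]
  · rw [im_smul_SL]; simp [dilation]
    rw [div_eq_iff (by positivity), ← Real.exp_nat_mul, ← Real.exp_add]
    congr 1; push_cast; ring

/-- The Möbius transformation `z ↦ -1 / z`. -/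
noncomputable def inversion : SpecialLinearGroup (Fin 2) ℝ :=
  ⟨!![0, -1; 1, 0], by simp [Matrix.det_fin_two_of]⟩

theorem inversion_smul_stdLine (t : ℝ) : inversion • stdLine t = stdLine (-t) := by
  apply UpperHalfPlane.ext_re_im
  · rw [re_smul_SL]; simp [inversion]
  · rw [im_smul_SL]; simp [inversion, Real.exp_neg]
    field_simp

theorem exists_smul_stdLine_of_stdLine (a b : ℝ) : ∃ A : SpecialLinearGroup (Fin 2) ℝ,
    A • stdLine 0 = stdLine a ∧ A • stdLine (dist (stdLine a) (stdLine b)) = stdLine b := by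
  rw [isometry_stdLine.dist_eq, Real.dist_eq]
  rcases le_total a b with h | h
  · refine ⟨dilation a, ?_, ?_⟩
    · simp [dilation_smul_stdLine]
    · rw [dilation_smul_stdLine, abs_of_nonpos (by linarith)]; congr 1; ring
  · refine ⟨dilation a * inversion, ?_, ?_⟩
    · simp [mul_smul, inversion_smul_stdLine, dilation_smul_stdLine]
    · rw [mul_smul, inversion_smul_stdLine, dilation_smul_stdLine, abs_of_nonneg (by linarith)]
      congr 1; ring

theorem exists_SL (a b c d : ℝ) (h : a * d - b * c = 1) :
    ∃ g : SpecialLinearGroup (Fin 2) ℝ, g 0 0 = a ∧ g 0 1 = b ∧ g 1 0 = c ∧ g 1 1 = d :=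
  ⟨⟨!![a, b; c, d], by rwa [Matrix.det_fin_two_of]⟩, rfl, rfl, rfl, rfl⟩

theorem exists_smul_re_eq_zero (z w : ℍ) : ∃ A : SpecialLinearGroup (Fin 2) ℝ,
    (A • z).re = 0 ∧ (A • w).re = 0 := by
  by_cases h : z.re = w.re
  · obtain ⟨g, ha, hb, hc, hd⟩ := exists_SL 1 (-z.re) 0 1 (by ring)
    refine ⟨g, ?_, ?_⟩
    · rw [re_smul_SL, ha, hb, hc, hd]; simp
    · rw [re_smul_SL, ha, hb, hc, hd]; simp [h]
  · have h' : z.re - w.re ≠ 0 := sub_ne_zero.2 h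
    -- The geodesic through both points is a half-circle with centre `m` and radius `r`. The matrix
    -- `g` below sends `m - r` to `0` and `m + r` to `∞`, hence the half-circle to the imaginary
    -- axis.
    obtain ⟨m, hm⟩ : ∃ m : ℝ, (z.re - m) ^ 2 + z.im ^ 2 = (w.re - m) ^ 2 + w.im ^ 2 :=
      ⟨(z.re ^ 2 + z.im ^ 2 - w.re ^ 2 - w.im ^ 2) / (2 * (z.re - w.re)), by field_simp; ring⟩
    have hpos : 0 < (z.re - m) ^ 2 + z.im ^ 2 := by have := z.im_pos; positivity
    obtain ⟨r, hr, hr2⟩ : ∃ r : ℝ, 0 < r ∧ r ^ 2 = (z.re - m) ^ 2 + z.im ^ 2 :=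
      ⟨_, Real.sqrt_pos.2 hpos, Real.sq_sqrt hpos.le⟩
    obtain ⟨k, hk0, hk⟩ : ∃ k : ℝ, k ≠ 0 ∧ k ^ 2 * (2 * r) = 1 :=
      ⟨1 / √(2 * r), by positivity, by
        rw [div_pow, Real.sq_sqrt (by positivity)]; field_simp⟩
    obtain ⟨g, ha, hb, hc, hd⟩ := exists_SL k (-(k * (m - r))) (-k) (k * (m + r))
      (by linear_combination hk)
    refine ⟨g, ?_, ?_⟩
    · rw [re_smul_SL, ha, hb, hc, hd, div_eq_zero_iff]
      left
      linear_combination k ^ 2 * hr2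
    · rw [re_smul_SL, ha, hb, hc, hd, div_eq_zero_iff]
      left
      linear_combination k ^ 2 * (hr2 + hm)

/-- Any two points are joined by the image of the standard line under a Möbius transformation. -/
theorem exists_smul_stdLine (z w : ℍ) : ∃ A : SpecialLinearGroup (Fin 2) ℝ,
    A • stdLine 0 = z ∧ A • stdLine (dist z w) = w := by
  obtain ⟨B, hz, hw⟩ := exists_smul_re_eq_zero z w
  obtain ⟨A, h1, h2⟩ := exists_smul_stdLine_of_stdLine (Real.log (B • z).im) (Real.log (B • w).im)
  rw [stdLine_log_im_of_re_eq_zero hz] at h1 h2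
  rw [stdLine_log_im_of_re_eq_zero hw, dist_smul] at h2
  exact ⟨B⁻¹ * A, by rw [mul_smul, h1, inv_smul_smul], by rw [mul_smul, h2, inv_smul_smul]⟩

/-! ### Displacement of Möbius transformations -/

/-- The displacement of `z` under `g` is given by the squared modulus of the quadratic polynomial
`c z² + (d - a) z - b`, whose roots are the fixed points of `g`. -/
theorem sinh_half_dist_smul_sq (g : SpecialLinearGroup (Fin 2) ℝ) (z : ℍ) :
    4 * z.im ^ 2 * Real.sinh (dist z (g • z) / 2) ^ 2 =
      (g 1 0 * (z.re ^ 2 - z.im ^ 2) + (g 1 1 - g 0 0) * z.re - g 0 1) ^ 2 +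
        (2 * g 1 0 * z.re * z.im + (g 1 1 - g 0 0) * z.im) ^ 2 := by
  have hdet := g.det_coe
  rw [Matrix.det_fin_two] at hdet
  have hy := z.im_pos
  have hD : 0 < (g 1 0 * z.re + g 1 1) ^ 2 + (g 1 0 * z.im) ^ 2 := by
    have := (g • z).im_pos
    rw [im_smul_SL] at this
    exact (div_pos_iff_of_pos_left hy).1 this
  rw [sinh_half_dist, div_pow, mul_pow, Real.sq_sqrt (mul_pos hy (g • z).im_pos).le,
    Complex.dist_eq, Complex.sq_norm, Complex.normSq_apply]
  simp only [Complex.sub_re, Complex.sub_im, UpperHalfPlane.coe_re, UpperHalfPlane.coe_im]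
  rw [re_smul_SL, im_smul_SL]
  generalize g 0 0 = a at *
  generalize g 0 1 = b at *
  generalize g 1 0 = c at *
  generalize g 1 1 = d at *
  generalize z.re = x at *
  generalize z.im = y at *
  -- With `D = |cz + d|²`, this is `|D (gz - z)|² = D |cz² + (d - a)z - b|²`.
  have hid : (a * c * (x ^ 2 + y ^ 2) + (a * d + b * c) * x + b * d -
      x * ((c * x + d) ^ 2 + (c * y) ^ 2)) ^ 2 +
      ((a * d - b * c) * y - y * ((c * x + d) ^ 2 + (c * y) ^ 2)) ^ 2 =
      ((c * x + d) ^ 2 + (c * y) ^ 2) * ((c * (x ^ 2 - y ^ 2) + (d - a) * x - b) ^ 2 +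
        (2 * c * x * y + (d - a) * y) ^ 2) := by ring
  rw [hdet, one_mul] at hid
  generalize (c * x + d) ^ 2 + (c * y) ^ 2 = D at *
  have hy' := hy.ne'
  have hD' := hD.ne'
  field_simp
  linear_combination 4 * hid

/-- The Busemann function of a real boundary point is 1-Lipschitz, in exponential form. -/
theorem busemann_le (α : ℝ) (z w : ℍ) : ((z.re - α) ^ 2 + z.im ^ 2) / z.im ≤
    Real.exp (dist z w) * (((w.re - α) ^ 2 + w.im ^ 2) / w.im) := by
  -- The map `z ↦ -1 / (z - α)` moves `α` to `∞`, where the Busemann function is read off the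
  -- imaginary part.
  obtain ⟨g, ha, hb, hc, hd⟩ := exists_SL 0 (-1) 1 (-α) (by ring)
  have h := im_div_exp_dist_le (g • w) (g • z)
  rw [dist_smul, dist_comm, im_smul_SL, im_smul_SL, hc, hd] at h
  have hz := z.im_pos
  have hw := w.im_pos
  have e := Real.exp_pos (dist z w)
  rw [div_div, div_le_div_iff₀ (by positivity) (by positivity)] at h
  rw [mul_div_assoc', div_le_div_iff₀ (by positivity) (by positivity)]
  linarith

theorem inv_im_le (z w : ℍ) : 1 / z.im ≤ Real.exp (dist z w) * (1 / w.im) := by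
  have h := im_div_exp_dist_le w z
  have hz := z.im_pos
  have hw := w.im_pos
  have e := Real.exp_pos (dist w z)
  rw [dist_comm]
  rw [div_le_iff₀ e] at h
  rw [mul_one_div, div_le_div_iff₀ hz hw]
  linarith

/-- The half-displacement of an isometry without fixed points changes by at most a factor
`exp (dist z w)`, after applying `sinh`. -/
theorem sinh_half_dist_smul_le {g : SpecialLinearGroup (Fin 2) ℝ} (hg : ∀ z : ℍ, g • z ≠ z)
    (z w : ℍ) : Real.sinh (dist z (g • z) / 2) ≤
      Real.exp (dist z w) * Real.sinh (dist w (g • w) / 2) := by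
  have hN : ∀ z : ℍ, Real.sinh (dist z (g • z) / 2) ^ 2 = ((g 1 0 * (z.re ^ 2 - z.im ^ 2) +
      (g 1 1 - g 0 0) * z.re - g 0 1) ^ 2 +
        (2 * g 1 0 * z.re * z.im + (g 1 1 - g 0 0) * z.im) ^ 2) / (4 * z.im ^ 2) := by
    intro z
    have := z.im_pos
    rw [← sinh_half_dist_smul_sq]
    field_simp
  have hs : ∀ z : ℍ, 0 ≤ Real.sinh (dist z (g • z) / 2) := fun z =>
    Real.sinh_nonneg_iff.2 (by positivity)
  refine le_of_sq_le_sq ?_ (mul_nonneg (Real.exp_pos _).le (hs w))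
  have hz := z.im_pos
  have hw := w.im_pos
  have e := Real.exp_pos (dist z w)
  rw [mul_pow]
  by_cases hc : g 1 0 = 0
  · by_cases hd : g 1 1 - g 0 0 = 0
    -- Both fixed points are at `∞`; each contributes a factor `1 / z.im`.
    · have k := inv_im_le z w
      have k2 := pow_le_pow_left₀ (by positivity) k 2
      rw [hN, hN, hc, hd]
      calc _ = g 0 1 ^ 2 / 4 * (1 / z.im) ^ 2 := by field_simp; ring
        _ ≤ g 0 1 ^ 2 / 4 * (Real.exp (dist z w) * (1 / w.im)) ^ 2 := by gcongr
        _ = _ := by field_simp; ring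
    · obtain ⟨α, hα⟩ : ∃ α, g 0 1 = (g 1 1 - g 0 0) * α := ⟨g 0 1 / (g 1 1 - g 0 0), by field_simp⟩
      have k := inv_im_le z w
      have k2 := busemann_le α z w
      rw [hN, hN, hc, hα]
      calc _ = (g 1 1 - g 0 0) ^ 2 / 4 * (1 / z.im) * (((z.re - α) ^ 2 + z.im ^ 2) / z.im) := by
            field_simp; ring
        _ ≤ (g 1 1 - g 0 0) ^ 2 / 4 * (Real.exp (dist z w) * (1 / w.im)) *
            (Real.exp (dist z w) * (((w.re - α) ^ 2 + w.im ^ 2) / w.im)) := by gcongr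
        _ = _ := by field_simp; ring
  -- A negative discriminant would give a root `x + iy` in `ℍ`, which `g` would fix.
  · have hdisc : 0 ≤ (g 1 1 - g 0 0) ^ 2 + 4 * g 1 0 * g 0 1 := by
      by_contra hneg
      push Not at hneg
      have hy : 0 < √(-((g 1 1 - g 0 0) ^ 2 + 4 * g 1 0 * g 0 1)) / |2 * g 1 0| :=
        div_pos (Real.sqrt_pos.2 (by linarith)) (by positivity)
      set y := √(-((g 1 1 - g 0 0) ^ 2 + 4 * g 1 0 * g 0 1)) / |2 * g 1 0| with hydef
      have hy2 : y ^ 2 * (2 * g 1 0) ^ 2 = -((g 1 1 - g 0 0) ^ 2 + 4 * g 1 0 * g 0 1) := by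
        rw [hydef, div_pow, Real.sq_sqrt (by linarith), sq_abs]
        field_simp
      obtain ⟨x, hx⟩ : ∃ x, 2 * g 1 0 * x = g 0 0 - g 1 1 :=
        ⟨(g 0 0 - g 1 1) / (2 * g 1 0), by field_simp⟩
      have h := sinh_half_dist_smul_sq g ⟨⟨x, y⟩, hy⟩
      have h1 : g 1 0 * (x ^ 2 - y ^ 2) + (g 1 1 - g 0 0) * x - g 0 1 = 0 := by
        have : 4 * g 1 0 * (g 1 0 * (x ^ 2 - y ^ 2) + (g 1 1 - g 0 0) * x - g 0 1) = 0 := by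
          linear_combination (-1) * hy2 + (2 * g 1 0 * x + (g 1 1 - g 0 0)) * hx
        simpa [hc] using this
      have h2 : 2 * g 1 0 * x * y + (g 1 1 - g 0 0) * y = 0 := by
        linear_combination y * hx
      simp only [UpperHalfPlane.mk_re, UpperHalfPlane.mk_im] at h
      rw [h1, h2] at h
      have h3 : Real.sinh (dist (⟨⟨x, y⟩, hy⟩ : ℍ) (g • ⟨⟨x, y⟩, hy⟩) / 2) = 0 := by
        have : 4 * y ^ 2 ≠ 0 := by positivity
        simpa [this, hy.ne'] using h
      rw [Real.sinh_eq_zero] at h3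
      exact hg _ (dist_eq_zero.1 (by linarith)).symm
    obtain ⟨α, β, h1, h2⟩ : ∃ α β : ℝ, g 1 1 - g 0 0 = -(g 1 0 * (α + β)) ∧
        g 0 1 = -(g 1 0 * (α * β)) := by
      have hsq := Real.sq_sqrt hdisc
      set s := √((g 1 1 - g 0 0) ^ 2 + 4 * g 1 0 * g 0 1)
      refine ⟨(-(g 1 1 - g 0 0) + s) / (2 * g 1 0), (-(g 1 1 - g 0 0) - s) / (2 * g 1 0), ?_, ?_⟩
      · field_simp; ring
      · field_simp
        linear_combination (-1) * hsq
    have k1 := busemann_le α z w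
    have k2 := busemann_le β z w
    rw [hN, hN, h1, h2]
    calc _ = g 1 0 ^ 2 / 4 * (((z.re - α) ^ 2 + z.im ^ 2) / z.im) *
          (((z.re - β) ^ 2 + z.im ^ 2) / z.im) := by field_simp; ring
      _ ≤ g 1 0 ^ 2 / 4 * (Real.exp (dist z w) * (((w.re - α) ^ 2 + w.im ^ 2) / w.im)) *
          (Real.exp (dist z w) * (((w.re - β) ^ 2 + w.im ^ 2) / w.im)) := by gcongr
      _ = _ := by field_simp; ring

/-- A Möbius transformation with two fixed points in the hyperbolic plane is the identity. -/
theorem smul_eq_of_fixed {g : SpecialLinearGroup (Fin 2) ℝ} {z w : ℍ} (hzw : z ≠ w)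
    (hz : g • z = z) (hw : g • w = w) (u : ℍ) : g • u = u := by
  have key : ∀ v : ℍ, g • v = v → g 1 0 * (v.re ^ 2 - v.im ^ 2) + (g 1 1 - g 0 0) * v.re - g 0 1 = 0
      ∧ 2 * g 1 0 * v.re + (g 1 1 - g 0 0) = 0 := by
    intro v hv
    have h := sinh_half_dist_smul_sq g v
    rw [hv] at h
    simp only [dist_self, zero_div, Real.sinh_zero] at h
    have hy := v.im_pos.ne'
    have h1 : g 1 0 * (v.re ^ 2 - v.im ^ 2) + (g 1 1 - g 0 0) * v.re - g 0 1 = 0 := by nlinarith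
    have h2 : (2 * g 1 0 * v.re + (g 1 1 - g 0 0)) * v.im = 0 := by nlinarith
    exact ⟨h1, by simpa [hy] using h2⟩
  obtain ⟨z1, z2⟩ := key z hz
  obtain ⟨w1, w2⟩ := key w hw
  -- A genuine real quadratic has at most one root in the upper half-plane.
  have hc : g 1 0 = 0 := by
    by_contra hc
    have hre : z.re = w.re := by
      have : 2 * g 1 0 * (z.re - w.re) = 0 := by linear_combination z2 - w2
      simpa [hc, sub_eq_zero] using this
    have him : z.im ^ 2 = w.im ^ 2 := by
      rw [hre] at z1
      have : g 1 0 * (z.im ^ 2 - w.im ^ 2) = 0 := by linear_combination w1 - z1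
      simpa [hc, sub_eq_zero] using this
    exact hzw (UpperHalfPlane.ext_re_im hre
      ((pow_left_inj₀ z.im_pos.le w.im_pos.le two_ne_zero).1 him))
  have hd : g 1 1 - g 0 0 = 0 := by simpa [hc] using z2
  have hb : g 0 1 = 0 := by simpa [hc, hd] using z1
  have h := sinh_half_dist_smul_sq g u
  rw [hc, hd, hb] at h
  have : Real.sinh (dist u (g • u) / 2) = 0 := by simpa [u.im_pos.ne'] using h
  rw [Real.sinh_eq_zero] at this
  exact (dist_eq_zero.1 (by linarith)).symm

/-! ### Locally Möbius maps and the identity theorem -/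

open Metric

variable {X : Type*} [TopologicalSpace X] [ChartedSpace ℍ X]

/-- `f` is near `z` a Möbius transformation followed by the inverse of a chart. -/
def IsLocallyMoebiusAt (f : ℍ → X) (z : ℍ) : Prop :=
  ∃ e ∈ atlas ℍ X, ∃ A : SpecialLinearGroup (Fin 2) ℝ, A • z ∈ e.target ∧
    f =ᶠ[𝓝 z] fun y => e.symm (A • y)

theorem tendsto_smul_nhds (A : SpecialLinearGroup (Fin 2) ℝ) (z : ℍ) :
    Filter.Tendsto (fun y : ℍ => A • y) (𝓝 z) (𝓝 (A • z)) :=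
  (isometry_smul ℍ A).continuous.tendsto z

theorem smul_eq_of_eventually {g : SpecialLinearGroup (Fin 2) ℝ} {z : ℍ}
    (h : ∀ᶠ y in 𝓝 z, g • y = y) (u : ℍ) : g • u = u := by
  obtain ⟨A, hA, -⟩ := exists_smul_stdLine z z
  have hc : Filter.Tendsto (fun t => A • stdLine t) (𝓝 0) (𝓝 z) := by
    have := ((isometry_smul ℍ A).continuous.comp isometry_stdLine.continuous).tendsto 0
    rwa [Function.comp_apply, hA] at this
  have h1 := (hc.eventually h).filter_mono (nhdsWithin_le_nhds (s := {0}ᶜ))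
  obtain ⟨t, ht, ht0⟩ := (h1.and self_mem_nhdsWithin).exists
  refine smul_eq_of_fixed (fun heq => ht0 ?_) ht h.self_of_nhds u
  rw [← hA] at heq
  exact isometry_stdLine.injective (smul_left_cancel A heq)

namespace IsLocallyMoebiusAt

variable {f g : ℍ → X} {z : ℍ}

theorem congr (hf : IsLocallyMoebiusAt f z) (h : g =ᶠ[𝓝 z] f) : IsLocallyMoebiusAt g z := by
  obtain ⟨e, he, A, hA, h'⟩ := hf
  exact ⟨e, he, A, hA, h.trans h'⟩

theorem continuousAt (hf : IsLocallyMoebiusAt f z) : ContinuousAt f z := by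
  obtain ⟨e, -, A, hA, h⟩ := hf
  refine ContinuousAt.congr ?_ h.symm
  exact (e.symm.continuousAt hA).comp (tendsto_smul_nhds A z)

theorem chart [IsHyperbolicSurface X] (hf : IsLocallyMoebiusAt f z)
    {e : OpenPartialHomeomorph X ℍ} (he : e ∈ atlas ℍ X) (hz : f z ∈ e.source) :
    ∃ A : SpecialLinearGroup (Fin 2) ℝ, ∀ᶠ y in 𝓝 z, f y ∈ e.source ∧ e (f y) = A • y := by
  obtain ⟨e', he', A, hA, h⟩ := id hf
  have hs : A • z ∈ (e'.symm.trans e).source := by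
    rw [OpenPartialHomeomorph.trans_source]
    refine ⟨hA, ?_⟩
    have h' : f z = e'.symm (A • z) := h.self_of_nhds
    rwa [mem_preimage, ← h']
  obtain ⟨C, hC⟩ := IsHyperbolicSurface.locally_moebius e' he' e he _ hs
  refine ⟨C * A, ?_⟩
  filter_upwards [h, (tendsto_smul_nhds A z).eventually hC,
    hf.continuousAt.eventually_mem (e.open_source.mem_nhds hz)] with y h1 h2 h3
  refine ⟨h3, ?_⟩
  rw [mul_smul, ← h2, h1]
  rfl

theorem comp_smul (A : SpecialLinearGroup (Fin 2) ℝ) (hf : IsLocallyMoebiusAt f (A • z)) :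
    IsLocallyMoebiusAt (fun y => f (A • y)) z := by
  obtain ⟨e, he, B, hB, h⟩ := hf
  refine ⟨e, he, B * A, by rwa [mul_smul], ?_⟩
  filter_upwards [(tendsto_smul_nhds A z).eventually h] with y hy
  rw [hy, mul_smul]

end IsLocallyMoebiusAt

/-- The identity theorem for locally Möbius maps. -/
theorem eventuallyEq_of_isPreconnected [T2Space X] [IsHyperbolicSurface X] {f g : ℍ → X}
    {S : Set ℍ} (hS : IsPreconnected S) (hf : ∀ z ∈ S, IsLocallyMoebiusAt f z)
    (hg : ∀ z ∈ S, IsLocallyMoebiusAt g z) {z₀ : ℍ} (hz₀ : z₀ ∈ S) (h : f =ᶠ[𝓝 z₀] g) :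
    ∀ z ∈ S, f =ᶠ[𝓝 z] g := by
  have hopen : IsOpen {z | f =ᶠ[𝓝 z] g} := isOpen_setOfPred_eventually_nhds
  refine hS.subset_of_closure_inter_subset hopen ⟨z₀, hz₀, h⟩ ?_
  rintro z ⟨hz, hzS⟩
  have hfr := mem_closure_iff_frequently.1 hz
  have heq : f z = g z := tendsto_nhds_unique_of_frequently_eq (hf z hzS).continuousAt
    (hg z hzS).continuousAt (hfr.mono fun y hy => Filter.EventuallyEq.eq_of_nhds hy)
  obtain ⟨B, hB⟩ := (hf z hzS).chart (chart_mem_atlas ℍ (f z)) (mem_chart_source ℍ (f z))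
  obtain ⟨C, hC⟩ := (hg z hzS).chart (chart_mem_atlas ℍ (f z))
    (heq ▸ mem_chart_source ℍ (f z))
  -- Near some `y` close to `z` the maps agree and both are Möbius in the chart, so `B` and `C` act
  -- alike near `y`, hence everywhere.
  obtain ⟨y, hy, hBC⟩ := (hfr.and_eventually (hB.and hC).eventually_nhds).exists
  have hfix : ∀ u : ℍ, (B⁻¹ * C) • u = u := by
    refine smul_eq_of_eventually (z := y) ?_
    filter_upwards [hy, hBC] with u hu h'
    rw [mul_smul, inv_smul_eq_iff, ← h'.2.2, ← hu, h'.1.2]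
  filter_upwards [hB, hC] with u h1 h2
  refine (chartAt ℍ (f z)).injOn h1.1 h2.1 ?_
  have := hfix u
  rw [mul_smul, inv_smul_eq_iff] at this
  rw [h1.2, h2.2, this]

/-- Hyperbolic balls are Euclidean discs, so the intersection is convex. -/
theorem isPreconnected_ball_inter_ball (z w : ℍ) (r s : ℝ) :
    IsPreconnected (ball z r ∩ ball w s) := by
  rw [← UpperHalfPlane.isEmbedding_coe.isInducing.isPreconnected_image,
    image_inter UpperHalfPlane.coe_injective, image_coe_ball, image_coe_ball]
  exact ((convex_ball _ _).inter (convex_ball _ _)).isPreconnected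

/-! ### Extension to the whole plane -/

/-- An inverse chart composed with a Möbius map extends the germ as far as the chart's target
allows; compactness of `X` makes this radius uniform. -/
theorem exists_uniform_extension [CompactSpace X] [IsHyperbolicSurface X] :
    ∃ ε > 0, ∀ (f : ℍ → X) (z : ℍ), IsLocallyMoebiusAt f z →
      ∃ F : ℍ → X, F =ᶠ[𝓝 z] f ∧ ∀ y ∈ ball z ε, IsLocallyMoebiusAt F y := by
  suffices h : ∃ ε > 0, ∀ (f : ℍ → X) (z : ℍ), IsLocallyMoebiusAt f z → f z ∈ (univ : Set X) →
      ∃ F : ℍ → X, F =ᶠ[𝓝 z] f ∧ ∀ y ∈ ball z ε, IsLocallyMoebiusAt F y by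
    simpa using h
  refine isCompact_univ.induction_on (p := fun s : Set X => ∃ ε > 0, ∀ (f : ℍ → X) (z : ℍ),
    IsLocallyMoebiusAt f z → f z ∈ s →
      ∃ F : ℍ → X, F =ᶠ[𝓝 z] f ∧ ∀ y ∈ ball z ε, IsLocallyMoebiusAt F y) ?_ ?_ ?_ ?_
  · exact ⟨1, one_pos, by simp⟩
  · rintro s t hst ⟨ε, hε, h⟩
    exact ⟨ε, hε, fun f z hf hz => h f z hf (hst hz)⟩
  · rintro s t ⟨ε, hε, h⟩ ⟨δ, hδ, h'⟩
    refine ⟨min ε δ, lt_min hε hδ, fun f z hf hz => ?_⟩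
    rcases hz with hz | hz
    · obtain ⟨F, hF, hF'⟩ := h f z hf hz
      exact ⟨F, hF, fun y hy => hF' y (ball_subset_ball (min_le_left _ _) hy)⟩
    · obtain ⟨F, hF, hF'⟩ := h' f z hf hz
      exact ⟨F, hF, fun y hy => hF' y (ball_subset_ball (min_le_right _ _) hy)⟩
  · intro x _
    set e := chartAt ℍ x with he
    have hx : x ∈ e.source := mem_chart_source ℍ x
    obtain ⟨ε, hε, hball⟩ := Metric.isOpen_iff.1 e.open_target (e x) (e.map_source hx)
    refine ⟨e.source ∩ e ⁻¹' ball (e x) (ε / 2), mem_nhdsWithin_of_mem_nhds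
      (Filter.inter_mem (e.open_source.mem_nhds hx)
        ((e.continuousAt hx).preimage_mem_nhds (ball_mem_nhds _ (by positivity)))),
      ε / 2, by positivity, ?_⟩
    rintro f z hf ⟨hz1, hz2⟩
    obtain ⟨A, hA⟩ := hf.chart (chart_mem_atlas ℍ x) hz1
    refine ⟨fun y => e.symm (A • y), ?_, fun y hy => ⟨e, chart_mem_atlas ℍ x, A, hball ?_, ?_⟩⟩
    · filter_upwards [hA] with y hy
      rw [← hy.2, e.left_inv hy.1]
    · rw [mem_preimage, hA.self_of_nhds.2, mem_ball] at hz2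
      rw [mem_ball] at hy ⊢
      rw [← dist_smul A] at hy
      linarith [dist_triangle (A • y) (A • z) (e x)]
    · exact Filter.EventuallyEq.rfl

theorem exists_mem_ball_dist_lt {z y : ℍ} {R δ : ℝ} (hR : 0 < R) (hδ : 0 < δ)
    (hy : dist z y < R + δ) : ∃ c ∈ ball z R, dist c y ≤ δ := by
  obtain ⟨A, h0, h1⟩ := exists_smul_stdLine z y
  refine ⟨A • stdLine (max 0 (dist z y - δ)), ?_, ?_⟩
  · rw [mem_ball]
    nth_rw 2 [← h0]
    rw [dist_smul, isometry_stdLine.dist_eq, Real.dist_eq, sub_zero,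
      abs_of_nonneg (le_max_left _ _)]
    exact max_lt hR (by linarith)
  · nth_rw 2 [← h1]
    rw [dist_smul, isometry_stdLine.dist_eq, Real.dist_eq, abs_le]
    have := dist_nonneg (x := z) (y := y)
    rcases max_cases 0 (dist z y - δ) with h | h <;> constructor <;> linarith

/-- The germs at points `c` of the ball are extended to balls of radius `ε` and glued by the
identity theorem. The margin `ε / 3` ensures that the centres chosen for neighbouring points `y`,
`y'` are less than `ε` apart, so each lies in the other's ball. -/
theorem exists_extension_ball [T2Space X] [IsHyperbolicSurface X] {ε : ℝ} (hε : 0 < ε)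
    (hext : ∀ (f : ℍ → X) (z : ℍ), IsLocallyMoebiusAt f z →
      ∃ F : ℍ → X, F =ᶠ[𝓝 z] f ∧ ∀ y ∈ ball z ε, IsLocallyMoebiusAt F y)
    {z₀ : ℍ} {R : ℝ} (hR : 0 < R) {f : ℍ → X} (hf : ∀ y ∈ ball z₀ R, IsLocallyMoebiusAt f y) :
    ∃ f' : ℍ → X, (∀ y ∈ ball z₀ (R + ε / 3), IsLocallyMoebiusAt f' y) ∧
      ∀ y ∈ ball z₀ R, f' y = f y := by
  have h1 : ∀ c : ℍ, ∃ F : ℍ → X, c ∈ ball z₀ R →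
      F =ᶠ[𝓝 c] f ∧ ∀ y ∈ ball c ε, IsLocallyMoebiusAt F y := by
    intro c
    by_cases hc : c ∈ ball z₀ R
    · obtain ⟨F, hF⟩ := hext f c (hf c hc)
      exact ⟨F, fun _ => hF⟩
    · exact ⟨f, fun h => absurd h hc⟩
  choose F hF using h1
  have h2 : ∀ y : ℍ, ∃ c, y ∈ ball z₀ (R + ε / 3) → c ∈ ball z₀ R ∧ dist c y ≤ ε / 3 := by
    intro y
    by_cases hy : y ∈ ball z₀ (R + ε / 3)
    · obtain ⟨c, hc⟩ := exists_mem_ball_dist_lt hR (by positivity : 0 < ε / 3) (mem_ball'.1 hy)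
      exact ⟨c, fun _ => hc⟩
    · exact ⟨y, fun h => absurd h hy⟩
  choose c hc using h2
  have h3 : ∀ c ∈ ball z₀ R, ∀ y ∈ ball c ε ∩ ball z₀ R, F c =ᶠ[𝓝 y] f := fun c hc =>
    eventuallyEq_of_isPreconnected (isPreconnected_ball_inter_ball _ _ _ _)
      (fun z hz => (hF c hc).2 z hz.1) (fun z hz => hf z hz.2)
      ⟨mem_ball_self hε, hc⟩ (hF c hc).1
  refine ⟨fun y => F (c y) y, fun y hy => ?_, fun y hy => ?_⟩
  · obtain ⟨hcy, hd⟩ := hc y hy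
    refine ((hF _ hcy).2 y (by rw [mem_ball']; linarith)).congr ?_
    filter_upwards [isOpen_ball.mem_nhds hy, ball_mem_nhds y (by positivity : 0 < ε / 3)]
      with y' hy' hyy'
    obtain ⟨hcy', hd'⟩ := hc y' hy'
    rw [mem_ball] at hyy'
    have hcc : c y ∈ ball (c y') ε := by
      rw [mem_ball]
      linarith [dist_triangle (c y) y (c y'), dist_triangle y y' (c y'), dist_comm y' (c y'),
        dist_comm y y']
    have := eventuallyEq_of_isPreconnected (isPreconnected_ball_inter_ball (c y') (c y) ε ε)
      (fun z hz => (hF _ hcy').2 z hz.1) (fun z hz => (hF _ hcy).2 z hz.2)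
      ⟨hcc, mem_ball_self hε⟩ ((h3 _ hcy' _ ⟨hcc, hcy⟩).trans (hF _ hcy).1.symm) y'
      ⟨by rw [mem_ball']; linarith, by
        rw [mem_ball]; linarith [dist_triangle y' y (c y), dist_comm y (c y)]⟩
    exact this.self_of_nhds
  · have hy' : y ∈ ball z₀ (R + ε / 3) := ball_subset_ball (by linarith) hy
    obtain ⟨hcy, hd⟩ := hc y hy'
    exact (h3 _ hcy y ⟨by rw [mem_ball']; linarith, hy⟩).self_of_nhds

/-- Every point of a closed hyperbolic surface is in the image of a locally Möbius map defined
on the whole hyperbolic plane. -/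
theorem exists_locallyMoebius [T2Space X] [CompactSpace X] [IsHyperbolicSurface X] (p : X) :
    ∃ (E : ℍ → X) (z : ℍ), E z = p ∧ ∀ y, IsLocallyMoebiusAt E y := by
  obtain ⟨ε, hε, hext⟩ := exists_uniform_extension (X := X)
  set e := chartAt ℍ p with he
  have hp : p ∈ e.source := mem_chart_source ℍ p
  have h0 : IsLocallyMoebiusAt (fun y => e.symm y) (e p) :=
    ⟨e, chart_mem_atlas ℍ p, 1, by simpa using e.map_source hp, by simp⟩
  obtain ⟨f₀, hf₀, hf₀'⟩ := hext _ _ h0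
  set r : ℕ → ℝ := fun n => ε + n * (ε / 3) with hr
  have hrpos : ∀ n, 0 < r n := fun n => by positivity
  have hrsucc : ∀ n, r (n + 1) = r n + ε / 3 := fun n => by simp only [hr]; push_cast; ring
  have hstep : ∀ n (f : {f : ℍ → X // ∀ y ∈ ball (e p) (r n), IsLocallyMoebiusAt f y}),
      ∃ f' : {f : ℍ → X // ∀ y ∈ ball (e p) (r (n + 1)), IsLocallyMoebiusAt f y},
        ∀ y ∈ ball (e p) (r n), f'.1 y = f.1 y := by
    rintro n ⟨f, hf⟩
    obtain ⟨f', h1, h2⟩ := exists_extension_ball hε hext (hrpos n) hf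
    exact ⟨⟨f', by rwa [hrsucc]⟩, h2⟩
  choose step hstep using hstep
  let s : ∀ n, {f : ℍ → X // ∀ y ∈ ball (e p) (r n), IsLocallyMoebiusAt f y} := fun n =>
    Nat.rec ⟨f₀, by simpa [hr] using hf₀'⟩ step n
  have hs : ∀ n, s (n + 1) = step n (s n) := fun n => rfl
  have hmono : Monotone r := monotone_nat_of_le_succ fun n => by rw [hrsucc]; linarith
  have hagree : ∀ m n, m ≤ n → ∀ y ∈ ball (e p) (r m), (s n).1 y = (s m).1 y := by
    intro m n hmn
    induction n, hmn using Nat.le_induction with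
    | base => exact fun _ _ => rfl
    | succ n hmn ih =>
      intro y hy
      rw [hs, hstep n (s n) y (ball_subset_ball (hmono hmn) hy), ih y hy]
  have hN : ∀ y : ℍ, ∃ n, y ∈ ball (e p) (r n) := by
    intro y
    obtain ⟨n, hn⟩ := exists_nat_gt (dist y (e p) / (ε / 3))
    refine ⟨n, ?_⟩
    rw [div_lt_iff₀ (by positivity)] at hn
    rw [mem_ball]
    simp only [hr]
    linarith
  -- The limit map uses, at `y`, any stage whose ball contains `y`; all such stages agree there.
  choose N hN using hN
  have hE : ∀ n, ∀ y ∈ ball (e p) (r n), (s (N y)).1 y = (s n).1 y := by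
    intro n y hy
    rcases le_total (N y) n with h | h
    · exact (hagree _ _ h y (hN y)).symm
    · exact hagree _ _ h y hy
  refine ⟨fun y => (s (N y)).1 y, e p, ?_, fun y => ?_⟩
  · show (s (N (e p))).1 (e p) = p
    rw [hE 0 _ (mem_ball_self (hrpos 0))]
    exact hf₀.self_of_nhds.trans (e.left_inv hp)
  · refine ((s (N y)).2 y (hN y)).congr ?_
    filter_upwards [isOpen_ball.mem_nhds (hN y)] with y' hy'
    exact hE _ _ hy'

/-! ### Lifting geodesics -/

theorem dist_smul_stdLine (A : SpecialLinearGroup (Fin 2) ℝ) (s t : ℝ) :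
    dist (A • stdLine s) (A • stdLine t) = |s - t| := by
  rw [dist_smul, isometry_stdLine.dist_eq, Real.dist_eq]

theorem eq_smul_stdLine_of_dist {A : SpecialLinearGroup (Fin 2) ℝ} {v : ℍ} {a b u : ℝ}
    (hab : a ≠ b) (ha : dist v (A • stdLine a) = |u - a|) (hb : dist v (A • stdLine b) = |u - b|) :
    v = A • stdLine u := by
  rw [← inv_smul_eq_iff]
  refine eq_stdLine_of_dist hab ?_ ?_
  · rw [← ha, ← dist_smul A, smul_inv_smul]
  · rw [← hb, ← dist_smul A, smul_inv_smul]

theorem continuous_smul_stdLine (A : SpecialLinearGroup (Fin 2) ℝ) :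
    Continuous fun t => A • stdLine t :=
  (isometry_smul ℍ A).continuous.comp isometry_stdLine.continuous

theorem injRadius_nonneg (p : X) : 0 ≤ injRadius p :=
  div_nonneg (Real.sInf_nonneg fun _ ⟨_, h⟩ => h.1.le) two_pos.le

theorem injRadius_le {p : X} {σ : ℝ → X} {L : ℝ} (h : IsGeodesicLoop p σ L) :
    injRadius p ≤ L / 2 :=
  div_le_div_of_nonneg_right (csInf_le ⟨0, fun _ ⟨_, h⟩ => h.1.le⟩ ⟨σ, h⟩) two_pos.le

variable [IsHyperbolicSurface X] {E : ℍ → X}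

theorem isGeodesic_comp_smul_stdLine (hE : ∀ z, IsLocallyMoebiusAt E z)
    (A : SpecialLinearGroup (Fin 2) ℝ) (L : ℝ) : IsGeodesic (fun t => E (A • stdLine t)) L := by
  have hc := continuous_smul_stdLine A
  refine ⟨((continuous_iff_continuousAt.2 fun z => (hE z).continuousAt).comp hc).continuousOn,
    fun s _ => ?_⟩
  obtain ⟨B, hB⟩ := (hE (A • stdLine s)).chart (chart_mem_atlas ℍ _) (mem_chart_source ℍ _)
  refine ⟨_, mem_nhdsWithin_of_mem_nhds ((hc.tendsto s).eventually hB), fun t ht t' ht' => ?_⟩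
  rw [ht.2, ht'.2, dist_smul, dist_smul_stdLine]

section

variable {τ : ℝ → X} {L : ℝ}

/-- In the chart the arc is an isometric image of an interval. The line through its start and one
further point `b` is forced to contain the rest, since distances to two points of a line determine a
point of it. -/
theorem IsGeodesic.exists_eventually_eq (hE : ∀ z, IsLocallyMoebiusAt E z) (hτ : IsGeodesic τ L)
    (hL : 0 < L) {w : ℍ} (hw : τ 0 = E w) : ∃ A : SpecialLinearGroup (Fin 2) ℝ,
      A • stdLine 0 = w ∧ ∀ᶠ t in 𝓝[Icc 0 L] 0, τ t = E (A • stdLine t) := by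
  have h0 : (0 : ℝ) ∈ Icc 0 L := ⟨le_rfl, hL.le⟩
  obtain ⟨U, hU, hiso⟩ := hτ.2 0 h0
  set e := chartAt ℍ (τ 0)
  have hsrc : τ 0 ∈ e.source := mem_chart_source ℍ _
  obtain ⟨B, hB⟩ := (hE w).chart (chart_mem_atlas ℍ (τ 0)) (hw ▸ hsrc)
  have hBw : e (τ 0) = B • w := by rw [hw]; exact hB.self_of_nhds.2
  have hne : (𝓝[Icc 0 L \ {0}] (0 : ℝ)).NeBot := by
    rw [Icc_sdiff_left, nhdsWithin_Ioc_eq_nhdsGT hL]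
    infer_instance
  obtain ⟨b, hbU, hbI, hb0⟩ : ∃ b ∈ U, b ∈ Icc 0 L ∧ b ≠ 0 := by
    have hm : U ∈ 𝓝[Icc 0 L \ {0}] (0 : ℝ) := nhdsWithin_mono _ sdiff_subset hU
    obtain ⟨b, hb, hb'⟩ := (hne.nonempty_of_mem (Filter.inter_mem hm self_mem_nhdsWithin))
    exact ⟨b, hb, hb'⟩
  have h0U := mem_of_mem_nhdsWithin h0 hU
  obtain ⟨A', hA0, hAb⟩ := exists_smul_stdLine (e (τ 0)) (e (τ b))
  rw [hiso 0 h0U b hbU, zero_sub, abs_neg, abs_of_nonneg hbI.1] at hAb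
  have hA : (B⁻¹ * A') • stdLine 0 = w := by rw [mul_smul, hA0, hBw, inv_smul_smul]
  refine ⟨B⁻¹ * A', hA, ?_⟩
  have hc := (continuous_smul_stdLine (B⁻¹ * A')).tendsto 0
  rw [hA] at hc
  filter_upwards [hU, (hτ.1 0 h0).eventually_mem (e.open_source.mem_nhds hsrc),
    (hc.eventually hB).filter_mono nhdsWithin_le_nhds] with t htU hts ht
  refine e.injOn hts ht.1 ?_
  rw [ht.2, mul_smul, smul_inv_smul]
  refine eq_smul_stdLine_of_dist hb0.symm ?_ ?_
  · rw [hA0, hiso t htU 0 h0U]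
  · rw [hAb, hiso t htU b hbU]

theorem IsGeodesic.eventually_eq (hE : ∀ z, IsLocallyMoebiusAt E z) (hτ : IsGeodesic τ L)
    {A : SpecialLinearGroup (Fin 2) ℝ} {s : ℝ} (hs : s ∈ Icc 0 L) (heq : τ s = E (A • stdLine s))
    (hfr : ∃ᶠ t in 𝓝[Icc 0 L] s, t ≠ s ∧ τ t = E (A • stdLine t)) :
    ∀ᶠ t in 𝓝[Icc 0 L] s, τ t = E (A • stdLine t) := by
  obtain ⟨U, hU, hiso⟩ := hτ.2 s hs
  set e := chartAt ℍ (τ s)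
  have hsrc : τ s ∈ e.source := mem_chart_source ℍ _
  obtain ⟨B, hB⟩ := (hE (A • stdLine s)).chart (chart_mem_atlas ℍ (τ s)) (heq ▸ hsrc)
  have hBs : e (τ s) = B • A • stdLine s := by rw [heq]; exact hB.self_of_nhds.2
  have hsU := mem_of_mem_nhdsWithin hs hU
  have hev := ((continuous_smul_stdLine A).tendsto s).eventually hB |>.filter_mono
    (nhdsWithin_le_nhds (s := Icc 0 L))
  obtain ⟨b, ⟨hbs, hb⟩, hbU, hb'⟩ := (hfr.and_eventually (Filter.Eventually.and hU hev)).exists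
  filter_upwards [hU, (hτ.1 s hs).eventually_mem (e.open_source.mem_nhds hsrc), hev]
    with t htU hts ht
  refine e.injOn hts ht.1 ?_
  rw [ht.2, ← mul_smul]
  refine eq_smul_stdLine_of_dist hbs.symm ?_ ?_
  · rw [mul_smul, ← hBs, hiso t htU s hsU]
  · rw [mul_smul, ← hb'.2, ← hb, hiso t htU b hbU]

/-- Geodesics lift through locally Möbius maps defined on the whole hyperbolic plane. -/
theorem IsGeodesic.exists_lift [T2Space X] (hE : ∀ z, IsLocallyMoebiusAt E z)
    (hτ : IsGeodesic τ L) (hL : 0 < L) {w : ℍ} (hw : τ 0 = E w) :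
    ∃ A : SpecialLinearGroup (Fin 2) ℝ,
      A • stdLine 0 = w ∧ ∀ t ∈ Icc 0 L, τ t = E (A • stdLine t) := by
  obtain ⟨A, hA, h0⟩ := hτ.exists_eventually_eq hE hL hw
  refine ⟨A, hA, ?_⟩
  let u : Set (Icc 0 L) :=
    {s | (fun t : Icc 0 L => τ t) =ᶠ[𝓝 s] fun t => E (A • stdLine (t : ℝ))}
  have hu : IsOpen u := isOpen_setOfPred_eventually_nhds
  have : PreconnectedSpace (Icc 0 L) := Subtype.preconnectedSpace isPreconnected_Icc
  have hEc : Continuous fun t : Icc 0 L => E (A • stdLine (t : ℝ)) :=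
    (continuous_iff_continuousAt.2 fun z => (hE z).continuousAt).comp
      ((continuous_smul_stdLine A).comp continuous_subtype_val)
  have hτc : Continuous fun t : Icc 0 L => τ t := continuousOn_iff_continuous_domRestrict.1 hτ.1
  have hsub : (univ : Set (Icc 0 L)) ⊆ u := by
    -- The parameters near which `τ` agrees with the projected line form an open and closed subset
    -- of the interval.
    refine isPreconnected_univ.subset_of_closure_inter_subset hu
      ⟨⟨0, le_rfl, hL.le⟩, mem_univ _, (eventually_nhds_subtype_iff _ _
        fun t => τ t = E (A • stdLine t)).2 h0⟩ ?_
    rintro s ⟨hs, -⟩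
    by_contra hsu
    have hfr := mem_closure_iff_frequently.1 hs
    have heq : τ s = E (A • stdLine (s : ℝ)) := tendsto_nhds_unique_of_frequently_eq
      hτc.continuousAt hEc.continuousAt (hfr.mono fun t ht => Filter.EventuallyEq.eq_of_nhds ht)
    refine hsu ((eventually_nhds_subtype_iff _ s fun t => τ t = E (A • stdLine t)).2
      (hτ.eventually_eq hE s.2 heq ?_))
    rw [← frequently_nhds_subtype_iff _ s fun t => t ≠ s ∧ τ t = E (A • stdLine t)]
    refine hfr.mono fun t ht => ⟨fun h => hsu ?_, Filter.EventuallyEq.eq_of_nhds ht⟩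
    rwa [← Subtype.ext h]
  intro t ht
  exact Filter.EventuallyEq.eq_of_nhds (hsub (mem_univ ⟨t, ht⟩))

end

/-! ### Deck transformations and geodesic loops -/

/-- Any two points in a fibre are exchanged by a Möbius transformation preserving the fibres. -/
theorem exists_deck [T2Space X] (hE : ∀ z, IsLocallyMoebiusAt E z) {w w' : ℍ} (h : E w = E w') :
    ∃ g : SpecialLinearGroup (Fin 2) ℝ, g • w = w' ∧ ∀ z, E (g • z) = E z := by
  have hsrc := mem_chart_source ℍ (E w)
  obtain ⟨B, hB⟩ := (hE w).chart (chart_mem_atlas ℍ (E w)) hsrc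
  obtain ⟨C, hC⟩ := (hE w').chart (chart_mem_atlas ℍ (E w)) (h ▸ hsrc)
  have hg : (C⁻¹ * B) • w = w' := by
    rw [mul_smul, inv_smul_eq_iff, ← hB.self_of_nhds.2, ← hC.self_of_nhds.2, h]
  have ht := tendsto_smul_nhds (C⁻¹ * B) w
  rw [hg] at ht
  refine ⟨C⁻¹ * B, hg, fun z => ?_⟩
  have key := eventuallyEq_of_isPreconnected (f := fun z => E ((C⁻¹ * B) • z)) (g := E)
    (S := ball w (dist z w + 1)) ?_ (fun z _ => (hE _).comp_smul _) (fun z _ => hE z)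
    (mem_ball_self (by positivity)) ?_ z (mem_ball.2 (by linarith))
  · exact key.eq_of_nhds
  · simpa using isPreconnected_ball_inter_ball w w (dist z w + 1) (dist z w + 1)
  · filter_upwards [hB, ht.eventually hC] with y hy hy'
    refine (chartAt ℍ (E w)).injOn hy'.1 hy.1 ?_
    rw [hy.2, hy'.2, mul_smul, smul_inv_smul]

/-- `E` is injective near a fixed point, so `g` would be the identity there, hence everywhere. -/
theorem deck_smul_ne (hE : ∀ z, IsLocallyMoebiusAt E z) {g : SpecialLinearGroup (Fin 2) ℝ}
    (hg : ∀ z, E (g • z) = E z) {w : ℍ} (hw : g • w ≠ w) (z : ℍ) : g • z ≠ z := by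
  intro hz
  obtain ⟨B, hB⟩ := (hE z).chart (chart_mem_atlas ℍ (E z)) (mem_chart_source ℍ (E z))
  have ht := tendsto_smul_nhds g z
  rw [hz] at ht
  refine hw (smul_eq_of_eventually (z := z) ?_ w)
  filter_upwards [hB, ht.eventually hB] with y h1 h2
  rw [← smul_left_cancel_iff B, ← h1.2, ← h2.2, hg]

theorem isGeodesicLoop_of_deck (hE : ∀ z, IsLocallyMoebiusAt E z)
    {g : SpecialLinearGroup (Fin 2) ℝ} (hg : ∀ z, E (g • z) = E z) {z : ℍ} (hz : g • z ≠ z) :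
    ∃ σ, IsGeodesicLoop (E z) σ (dist z (g • z)) := by
  obtain ⟨A, h0, h1⟩ := exists_smul_stdLine z (g • z)
  exact ⟨fun t => E (A • stdLine t), dist_pos.2 hz.symm, by simp only [h0],
    by simp only [h1, hg], isGeodesic_comp_smul_stdLine hE A _⟩

/-- The loop lifts to a segment of length `L` from `w`; its ends lie in one fibre, and the deck
transformation matching them moves `w` because `L` is positive. -/
theorem IsGeodesicLoop.exists_deck [T2Space X] (hE : ∀ z, IsLocallyMoebiusAt E z) {w : ℍ}
    {τ : ℝ → X} {L : ℝ} (hτ : IsGeodesicLoop (E w) τ L) :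
    ∃ g : SpecialLinearGroup (Fin 2) ℝ, (∀ z, E (g • z) = E z) ∧ (∀ z : ℍ, g • z ≠ z) ∧
      dist w (g • w) = L := by
  obtain ⟨hL, h0, h1, hgeo⟩ := hτ
  obtain ⟨A, hA, hlift⟩ := hgeo.exists_lift hE hL h0
  have hEL : E w = E (A • stdLine L) := by rw [← hlift L ⟨hL.le, le_rfl⟩, h1]
  obtain ⟨g, hgw, hg⟩ := HyperbolicSurface.exists_deck hE hEL
  have hd : dist w (g • w) = L := by
    rw [hgw, ← hA, dist_smul_stdLine, zero_sub, abs_neg, abs_of_pos hL]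
  exact ⟨g, hg, deck_smul_ne hE hg (w := w) (dist_pos.1 (hd ▸ hL)).symm, hd⟩

/-! ### Variation of the injectivity radius -/

/-- Along a locally Möbius map with a nontrivial deck transformation, `log (sinh injRadius)` is
1-Lipschitz, in exponential form. -/
theorem sinh_injRadius_le [T2Space X] (hE : ∀ z, IsLocallyMoebiusAt E z)
    {g₀ : SpecialLinearGroup (Fin 2) ℝ} (hg₀ : ∀ z, E (g₀ • z) = E z) (hfix : ∀ z : ℍ, g₀ • z ≠ z)
    (z w : ℍ) :
    Real.sinh (injRadius (E z)) ≤ Real.exp (dist z w) * Real.sinh (injRadius (E w)) := by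
  have e := Real.exp_pos (dist z w)
  have hlow : ∀ L ∈ {L : ℝ | ∃ σ : ℝ → X, IsGeodesicLoop (E w) σ L},
      2 * Real.arsinh (Real.sinh (injRadius (E z)) / Real.exp (dist z w)) ≤ L := by
    rintro L ⟨τ, hτ⟩
    -- The deck transformation of a loop at `E w` also produces a loop at `E z`, with comparable
    -- length.
    obtain ⟨g, hg, hgf, rfl⟩ := hτ.exists_deck hE
    obtain ⟨σ, hσ⟩ := isGeodesicLoop_of_deck hE hg (hgf z)
    have h1 := Real.sinh_le_sinh.2 (injRadius_le hσ)
    have h2 := h1.trans (sinh_half_dist_smul_le hgf z w)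
    have h3 : Real.arsinh (Real.sinh (injRadius (E z)) / Real.exp (dist z w)) ≤
        dist w (g • w) / 2 := by
      rw [← Real.sinh_le_sinh, Real.sinh_arsinh, div_le_iff₀ e]
      linarith
    linarith
  -- `g₀` guarantees that the set of lengths is nonempty; otherwise its `sInf` would be the default
  -- `0`.
  obtain ⟨σ, hσ⟩ := isGeodesicLoop_of_deck hE hg₀ (hfix w)
  have h1 : _ ≤ sInf {L : ℝ | ∃ σ : ℝ → X, IsGeodesicLoop (E w) σ L} :=
    le_csInf ⟨dist w (g₀ • w), σ, hσ⟩ hlow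
  have h2 : Real.arsinh (Real.sinh (injRadius (E z)) / Real.exp (dist z w)) ≤
      injRadius (E w) := by
    rw [injRadius.eq_def (E w)]; linarith
  rw [← Real.sinh_le_sinh, Real.sinh_arsinh, div_le_iff₀ e] at h2
  linarith

theorem continuous_injRadius_comp [T2Space X] (hE : ∀ z, IsLocallyMoebiusAt E z)
    {g₀ : SpecialLinearGroup (Fin 2) ℝ} (hg₀ : ∀ z, E (g₀ • z) = E z)
    (hfix : ∀ z : ℍ, g₀ • z ≠ z) : Continuous fun z => injRadius (E z) := by
  have hs : Continuous fun z => Real.sinh (injRadius (E z)) := by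
    refine continuous_iff_continuousAt.2 fun w => ?_
    have hd : Continuous fun z : ℍ => Real.exp (dist z w) := by fun_prop
    have h1 : Filter.Tendsto (fun z : ℍ => Real.sinh (injRadius (E w)) / Real.exp (dist z w)) (𝓝 w)
        (𝓝 (Real.sinh (injRadius (E w)))) := by
      have := (continuous_const.div hd (fun z => (Real.exp_pos _).ne')).tendsto
        (f := fun z : ℍ => Real.sinh (injRadius (E w)) / Real.exp (dist z w)) w
      simpa using this
    have h2 : Filter.Tendsto (fun z : ℍ => Real.exp (dist z w) * Real.sinh (injRadius (E w))) (𝓝 w)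
        (𝓝 (Real.sinh (injRadius (E w)))) := by
      have := (hd.mul continuous_const).tendsto
        (f := fun z : ℍ => Real.exp (dist z w) * Real.sinh (injRadius (E w))) w
      simpa using this
    refine tendsto_of_tendsto_of_tendsto_of_le_of_le h1 h2 (fun z => ?_) fun z =>
      sinh_injRadius_le hE hg₀ hfix z w
    have := sinh_injRadius_le hE hg₀ hfix w z
    rw [dist_comm] at this
    exact (div_le_iff₀ (Real.exp_pos _)).2 (by linarith)
  simpa [Function.comp_def] using Real.continuous_arsinh.comp hs

/-! ### The constant -/

/-- `(1 - exp (-2R)) / 2` increases with `R` and equals `√2 - 1` at `arsinh 1`, where `exp R = 1 +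
√2`. Finally `exp √2 ≥ 1 + √2 = 1 / (√2 - 1)`. -/
theorem exp_neg_sqrt_two_le_sinh {R L : ℝ} (hR : Real.arsinh 1 < R) (hL : 0 ≤ L) {d : ℝ}
    (hd : d ≤ R) (h : Real.sinh R ≤ Real.exp d * Real.sinh L) : Real.exp (-√2) ≤ Real.sinh L := by
  have h2 : (√2 : ℝ) ^ 2 = 2 := Real.sq_sqrt two_pos.le
  have h0 := Real.sqrt_nonneg 2
  have he : 1 + √2 < Real.exp R := by
    rw [← Real.log_lt_iff_lt_exp (by positivity)]
    simpa [Real.arsinh, one_add_one_eq_two] using hR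
  have h3 : Real.sinh R ≤ Real.exp R * Real.sinh L :=
    h.trans (mul_le_mul_of_nonneg_right (Real.exp_le_exp.2 hd) (Real.sinh_nonneg_iff.2 hL))
  have h4 : √2 - 1 ≤ Real.sinh L := by
    have hpos := Real.exp_pos R
    rw [Real.sinh_eq R, Real.exp_neg] at h3
    have h5 : Real.exp R ^ 2 - 1 ≤ 2 * Real.exp R ^ 2 * Real.sinh L := by
      have := mul_le_mul_of_nonneg_left h3 (by positivity : 0 ≤ 2 * Real.exp R)
      have e1 : Real.exp R * (Real.exp R)⁻¹ = 1 := mul_inv_cancel₀ hpos.ne'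
      nlinarith
    have h6 : (1 + √2) ^ 2 ≤ Real.exp R ^ 2 := pow_le_pow_left₀ (by positivity) he.le 2
    have h7 : 2 * (√2 - 1) * Real.exp R ^ 2 ≤ Real.exp R ^ 2 - 1 := by nlinarith
    have h8 : 0 ≤ 2 * Real.exp R ^ 2 * (Real.sinh L - (√2 - 1)) := by linarith
    by_contra hcon
    push Not at hcon
    have : 2 * Real.exp R ^ 2 * (Real.sinh L - (√2 - 1)) < 0 :=
      mul_neg_of_pos_of_neg (by positivity) (by linarith)
    linarith
  have h5 : Real.exp (-√2) ≤ √2 - 1 := by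
    rw [Real.exp_neg, inv_le_iff_one_le_mul₀ (Real.exp_pos _)]
    have := Real.add_one_le_exp (√2)
    have h1 : 1 ≤ √2 := by rw [Real.one_le_sqrt]; norm_num
    nlinarith
  exact h5.trans h4

theorem log_eq_arsinh_exp :
    Real.log (Real.exp (-√2) + √(Real.exp (-2 * √2) + 1)) = Real.arsinh (Real.exp (-√2)) := by
  rw [Real.arsinh, ← Real.exp_nat_mul, add_comm (Real.exp (-2 * √2))]
  congr 5
  push_cast; ring_nf

theorem exp_neg_sqrt_two_bounds :
    0.24311 < Real.exp (-√2) ∧ Real.exp (-√2) < 0.24312 := by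
  have hlo : 1.414213 < √2 := Real.lt_sqrt_of_sq_lt (by norm_num)
  have hhi : √2 < 1.414214 := (Real.sqrt_lt' (by norm_num)).2 (by norm_num)
  -- The Taylor bound needs an argument of modulus at most `1`, so `√2 / 2` is used and the result
  -- squared.
  have h1 := Real.exp_bound (x := -0.7071065) (by norm_num [abs_of_pos]) (n := 9) (by norm_num)
  have h2 := Real.exp_bound (x := -0.7071070) (by norm_num [abs_of_pos]) (n := 9) (by norm_num)
  rw [abs_le] at h1 h2
  norm_num [Finset.sum_range_succ, Nat.factorial] at h1 h2
  have hsq : Real.exp (-√2) = Real.exp (-√2 / 2) ^ 2 := by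
    rw [← Real.exp_nat_mul]; congr 1; push_cast; ring
  have k1 : Real.exp (-√2 / 2) ≤ Real.exp (-(1414213 / 2000000)) :=
    Real.exp_le_exp.2 (by linarith)
  have k2 : Real.exp (-(707107 / 1000000)) ≤ Real.exp (-√2 / 2) :=
    Real.exp_le_exp.2 (by linarith)
  have l1 : Real.exp (-√2 / 2) < 0.49307 := by linarith
  have l2 : 0.493065 < Real.exp (-√2 / 2) := by linarith
  rw [hsq]
  constructor <;> nlinarith

theorem arsinh_exp_neg_sqrt_two_bounds :
    0.2407 < Real.arsinh (Real.exp (-√2)) ∧ Real.arsinh (Real.exp (-√2)) < 0.2408 := by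
  obtain ⟨h1, h2⟩ := exp_neg_sqrt_two_bounds
  rw [← Real.sinh_lt_sinh, ← Real.sinh_lt_sinh (x := Real.arsinh _), Real.sinh_arsinh,
    Real.sinh_eq, Real.sinh_eq]
  have a1 := Real.exp_bound (x := 0.2407) (by norm_num [abs_of_pos]) (n := 6) (by norm_num)
  have a2 := Real.exp_bound (x := -0.2407) (by norm_num [abs_of_pos]) (n := 6) (by norm_num)
  have b1 := Real.exp_bound (x := 0.2408) (by norm_num [abs_of_pos]) (n := 6) (by norm_num)
  have b2 := Real.exp_bound (x := -0.2408) (by norm_num [abs_of_pos]) (n := 6) (by norm_num)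
  rw [abs_le] at a1 a2 b1 b2
  norm_num [Finset.sum_range_succ, Nat.factorial] at a1 a2 b1 b2 h1 h2 ⊢
  constructor <;> linarith

end HyperbolicSurface

/-! ### The minimum along the loop -/

theorem mainTheorem10 {X : Type*} [TopologicalSpace X] [T2Space X] [CompactSpace X]
    [ConnectedSpace X] [ChartedSpace UpperHalfPlane X] [HyperbolicSurface.IsHyperbolicSurface X]
    (p : X) (hp : Real.arsinh 1 < HyperbolicSurface.injRadius p)
    (σ : ℝ → X)
    (hσ : HyperbolicSurface.IsShortestGeodesicLoop p σ (2 * HyperbolicSurface.injRadius p)) :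
    (∃ m : ℝ,
      IsLeast ((fun s : ℝ => HyperbolicSurface.injRadius (σ s)) ''
        Set.Icc 0 (2 * HyperbolicSurface.injRadius p)) m ∧
      Real.log (Real.exp (-√2) + √(Real.exp (-2 * √2) + 1)) ≤ m) ∧
    0.2407 < Real.log (Real.exp (-√2) + √(Real.exp (-2 * √2) + 1)) ∧
    Real.log (Real.exp (-√2) + √(Real.exp (-2 * √2) + 1)) < 0.2408 := by
  open HyperbolicSurface in
  rw [log_eq_arsinh_exp]
  refine ⟨?_, arsinh_exp_neg_sqrt_two_bounds⟩
  obtain ⟨E, z₀, rfl, hE⟩ := exists_locallyMoebius p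
  have hloop := hσ.1
  obtain ⟨hL, h0, h1, hgeo⟩ := id hloop
  obtain ⟨A, hA, hlift⟩ := hgeo.exists_lift hE hL h0
  obtain ⟨g₀, hg₀, hfix, -⟩ := hloop.exists_deck hE
  set R := injRadius (E z₀) with hR
  have hEL : E (A • stdLine (2 * R)) = E z₀ := by
    rw [← hlift _ ⟨hL.le, le_rfl⟩, h1]
  have hc : ContinuousOn (fun s => injRadius (σ s)) (Icc 0 (2 * R)) := by
    have := (continuous_injRadius_comp hE hg₀ hfix).comp (continuous_smul_stdLine A)
    refine this.continuousOn.congr fun s hs => ?_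
    simp only [hlift s hs, Function.comp_apply]
  obtain ⟨s, hs, hmin⟩ := isCompact_Icc.exists_isMinOn ⟨0, le_rfl, hL.le⟩ hc
  refine ⟨injRadius (σ s), ⟨mem_image_of_mem _ hs, ?_⟩, ?_⟩
  · rintro _ ⟨t, ht, rfl⟩
    exact hmin ht
  · rw [← Real.sinh_le_sinh, Real.sinh_arsinh, hlift s hs]
    have hnn := injRadius_nonneg (E (A • stdLine s))
    -- Both ends of the lifted loop project to the base point; the nearer one is at distance at most
    -- `R`.
    rcases le_total s R with h | h
    · have key := sinh_injRadius_le hE hg₀ hfix (A • stdLine 0) (A • stdLine s)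
      rw [dist_smul_stdLine, hA, ← hR, zero_sub, abs_neg, abs_of_nonneg hs.1] at key
      exact exp_neg_sqrt_two_le_sinh hp hnn h key
    · have key := sinh_injRadius_le hE hg₀ hfix (A • stdLine (2 * R)) (A • stdLine s)
      rw [dist_smul_stdLine, hEL, ← hR, abs_of_nonneg (sub_nonneg.2 hs.2)] at key
      exact exp_neg_sqrt_two_le_sinh hp hnn (by linarith) key
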